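/- Let $G$ be a real Lie group and let $V$ be a finite-dimensional real vector space. A representation $(G,V)$ is a smooth group homomorphism $\Phi:G\to \mathrm{Aut}(V)$. Two representations $\Phi:G\to\mathrm{Aut}(V)$ and $\Phi':G\to\mathrm{Aut}(V')$ are equivalent if there is an intertwining isomorphism between them, that is, a linear isomorphism $A:V\to V'$ with $A(\Phi(a)p)=\Phi'(a)(Ap)$ for all $a\in G$, $p\in V$. The tangent bundle $TG$ is a Lie group, whose product is the tangent map of the product of $G$ (with $T(G\times G)\cong TG\times TG$). The tangent bundle $TV$ is a vector space of dimension $2\dim V$ with the operations $X\oplus Y=(T\tau_y)X+(T\tau_x)Y$ for $X\in T_xV$, $Y\in T_yV$, and $\lambda\bullet X=(T\sigma_\lambda)X$, where $\tau_x$ is the translation by $x$ and $\sigma_\lambda$ is the multiplication by $\lambda$. Let $\alpha=(\alpha_1,\dots,\alpha_n)$ be a basis of $V$. Let $\psi:TV\to V\times\mathbb R^n$ be the linear isomorphism $\psi\big(\sum_i v_i(\partial/\partial x_i)_p\big)=(p,(v_1,\dots,v_n))$, where $x_1,\dots,x_n$ are the linear coordinates of $\alpha$. Let $Z:\mathrm{Aut}(V)\to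 GL(n,\mathbb R)$ and $\breve Z:\mathrm{Aut}(TV)\to GL(2n,\mathbb R)$ be the isomorphisms that send an automorphism to its matrix in the basis $\alpha$ of $V$ and in the basis $\psi^{-1}(\alpha_1,0),\dots,\psi^{-1}(\alpha_n,0),\psi^{-1}(0,e_1),\dots,\psi^{-1}(0,e_n)$ of $TV$, respectively. Let $$J_n:T(GL(n,\mathbb R))\to GL(2n,\mathbb R),\qquad J_n(Y)=\begin{pmatrix}a&0\\ Ba&a\end{pmatrix}\quad\text{for } Y\in T_a GL(n,\mathbb R),\ B=(TR_{a^{-1}})Y,$$ where $R_{a^{-1}}$ is the right translation by $a^{-1}$. The prolongation $(TG,TV)$ of $\Phi$ is the representation $$\widetilde\Phi=\breve Z^{-1}\circ J_n\circ TZ\circ T\Phi:TG\to\mathrm{Aut}(TV).$$ **Proposition.** Let $\Phi:G\to\mathrm{Aut}(V)$ and $\Phi':G\to\mathrm{Aut}(V')$ be representations of a Lie group $G$ on finite-dimensional real vector spaces, and let $\widetilde\Phi$ and $\widetilde\Phi'$ be their prolongations, formed with any bases of $V$ and $V'$. If $\Phi$ and $\Phi'$ are equivalent, then $\widetilde\Phi$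 and $\widetilde\Phi'$ are equivalent. More precisely, if $A:V\to V'$ is an intertwining isomorphism from $\Phi$ to $\Phi'$, then the tangent map $TA:TV\to TV'$ is a linear isomorphism and $$TA\big(\widetilde\Phi(X)(Y)\big)=\widetilde\Phi'(X)\big(TA(Y)\big)\qquad\text{for all } X\in TG,\ Y\in TV.$$ -/

import Mathlib

open Bundle
open scoped Manifold ContDiff

noncomputable section

namespace Prolongation

section TangentGroup

variable {E : Type*} [NormedAddCommGroup E] [NormedSpace ℝ E]
  {H : Type*} [TopologicalSpace H] {I : ModelWithCorners ℝ E H}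
  {G : Type*} [TopologicalSpace G] [ChartedSpace H G] [Group G]

/-- The product of `TG`: the tangent map of the product of `G`, read on `TG × TG ≃ T(G × G)`. -/
instance instMulTangent : Mul (TangentBundle I G) where
  mul X Y := tangentMap (I.prod I) I (fun p : G × G => p.1 * p.2)
    ((equivTangentBundleProd I G I G).symm (X, Y))

/-- The unit of `TG`: the zero vector at the unit of `G`. -/
instance instOneTangent : One (TangentBundle I G) where
  one := ⟨1, 0⟩

/-- The inverse of `TG`: the tangent map of the inverse of `G`. -/
instance instInvTangent : Inv (TangentBundle I G) where
  inv X := tangentMap I I (fun g : G => g⁻¹) X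

variable {E₁ : Type*} [NormedAddCommGroup E₁] [NormedSpace ℝ E₁]
  {H₁ : Type*} [TopologicalSpace H₁] {J : ModelWithCorners ℝ E₁ H₁}
  {M : Type*} [TopologicalSpace M] [ChartedSpace H₁ M]

lemma tangentMap_const_one (Z : TangentBundle J M) :
    tangentMap J I (fun _ : M => (1 : G)) Z = 1 := by
  simp only [tangentMap, mfderiv_const]
  rfl

lemma tangentMap_mul [LieGroup I ∞ G] {u v : M → G} (hu : MDifferentiable J I u)
    (hv : MDifferentiable J I v) (Z : TangentBundle J M) :
    tangentMap J I (fun m => u m * v m) Z = tangentMap J I u Z * tangentMap J I v Z := by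
  have hm : MDifferentiable (I.prod I) I (fun p : G × G => p.1 * p.2) :=
    (contMDiff_mul I ∞).mdifferentiable (by simp)
  have h := tangentMap_comp_at (I := J) (I' := I.prod I) (I'' := I)
    (g := fun p : G × G => p.1 * p.2) (f := fun m => (u m, v m)) Z (hm _)
    ((hu _).prodMk (hv _))
  refine h.trans ?_
  change _ = tangentMap (I.prod I) I (fun p : G × G => p.1 * p.2) _
  congr 1
  simp only [tangentMap]
  rw [mfderiv_prodMk (hu _) (hv _)]
  rfl

instance instGroupTangent [LieGroup I ∞ G] : Group (TangentBundle I G) where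
  mul_assoc X Y W := by
    let Z : TangentBundle (I.prod (I.prod I)) (G × G × G) :=
      (equivTangentBundleProd I G (I.prod I) (G × G)).symm
        (X, (equivTangentBundleProd I G I G).symm (Y, W))
    have m1 : MDifferentiable (I.prod (I.prod I)) I (fun p : G × G × G => p.1) :=
      mdifferentiable_fst
    have m2 : MDifferentiable (I.prod (I.prod I)) I (fun p : G × G × G => p.2.1) :=
      mdifferentiable_fst.comp mdifferentiable_snd
    have m3 : MDifferentiable (I.prod (I.prod I)) I (fun p : G × G × G => p.2.2) :=
      mdifferentiable_snd.comp mdifferentiable_snd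
    have mm : MDifferentiable (I.prod I) I (fun p : G × G => p.1 * p.2) :=
      (contMDiff_mul I ∞).mdifferentiable (by simp)
    have h1 : tangentMap (I.prod (I.prod I)) I (fun p : G × G × G => p.1) Z = X := by
      refine (tangentMap_prodFst (I := I) (I' := I.prod I)).trans ?_
      rfl
    have h23 : tangentMap (I.prod (I.prod I)) (I.prod I) (Prod.snd : G × G × G → G × G) Z
        = (equivTangentBundleProd I G I G).symm (Y, W) := by
      refine (tangentMap_prodSnd (I := I) (I' := I.prod I)).trans ?_
      rfl
    have h2 : tangentMap (I.prod (I.prod I)) I (fun p : G × G × G => p.2.1) Z = Y := by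
      refine (tangentMap_comp_at (I := I.prod (I.prod I)) (I' := I.prod I) (I'' := I)
        (g := (Prod.fst : G × G → G)) (f := Prod.snd) Z mdifferentiableAt_fst
        mdifferentiableAt_snd).trans ?_
      rw [h23]
      exact tangentMap_prodFst
    have h3 : tangentMap (I.prod (I.prod I)) I (fun p : G × G × G => p.2.2) Z = W := by
      refine (tangentMap_comp_at (I := I.prod (I.prod I)) (I' := I.prod I) (I'' := I)
        (g := (Prod.snd : G × G → G)) (f := Prod.snd) Z mdifferentiableAt_snd
        mdifferentiableAt_snd).trans ?_
      rw [h23]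
      exact tangentMap_prodSnd
    have m12 : MDifferentiable (I.prod (I.prod I)) I (fun p : G × G × G => p.1 * p.2.1) :=
      mm.comp (m1.prodMk m2)
    have m23 : MDifferentiable (I.prod (I.prod I)) I (fun p : G × G × G => p.2.1 * p.2.2) :=
      mm.comp (m2.prodMk m3)
    rw [← h1, ← h2, ← h3, ← tangentMap_mul m1 m2, ← tangentMap_mul m12 m3,
      ← tangentMap_mul m2 m3, ← tangentMap_mul m1 m23]
    simp only [mul_assoc]
  one_mul X := by
    have h := tangentMap_mul (I := I) (J := I) (u := fun _ : G => (1 : G)) (v := id)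
      mdifferentiable_const mdifferentiable_id X
    rw [tangentMap_const_one, tangentMap_id] at h
    simp only [one_mul] at h
    exact h.symm.trans (congrFun tangentMap_id X)
  mul_one X := by
    have h := tangentMap_mul (I := I) (J := I) (v := fun _ : G => (1 : G)) (u := id)
      mdifferentiable_id mdifferentiable_const X
    rw [tangentMap_const_one, tangentMap_id] at h
    simp only [mul_one] at h
    exact h.symm.trans (congrFun tangentMap_id X)
  inv_mul_cancel X := by
    have h := tangentMap_mul (I := I) (J := I) (u := fun g : G => g⁻¹) (v := id)
      ((contMDiff_inv I ∞).mdifferentiable (by simp)) mdifferentiable_id X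
    rw [tangentMap_id] at h
    simp only [id, inv_mul_cancel] at h
    exact h.symm.trans (tangentMap_const_one X)

instance instLieGroupTangent [LieGroup I ∞ G] :
    LieGroup I.tangent ∞ (TangentBundle I G) where
  contMDiff_mul := by
    have h : ContMDiff (I.prod I).tangent I.tangent ∞
        (tangentMap (I.prod I) I (fun p : G × G => p.1 * p.2)) :=
      (contMDiff_mul I ∞).contMDiff_tangentMap (by simp)
    exact h.comp contMDiff_equivTangentBundleProd_symm
  contMDiff_inv := (contMDiff_inv I ∞).contMDiff_tangentMap (by simp)

/-- The tangent map of a homomorphism of Lie groups is a homomorphism of Lie groups. -/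
def tangentHom [LieGroup I ∞ G] {G' : Type*} [TopologicalSpace G'] [ChartedSpace H₁ G'] [Group G']
    [LieGroup J ∞ G'] (γ : ContMDiffMonoidMorphism I J ∞ G G') :
    ContMDiffMonoidMorphism I.tangent J.tangent ∞ (TangentBundle I G) (TangentBundle J G') where
  toFun := tangentMap I J γ
  map_one' := by
    refine TotalSpace.ext (map_one γ) ?_
    simp only [tangentMap]
    exact heq_of_eq_of_heq (map_zero (mfderiv I J γ (1 : G))) (by rw [map_one γ]; rfl)
  map_mul' X Y := by
    have hγ : MDifferentiable I J γ := γ.contMDiff_toFun.mdifferentiable (by simp)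
    let Z := (equivTangentBundleProd I G I G).symm (X, Y)
    have hm : MDifferentiable (I.prod I) I (fun p : G × G => p.1 * p.2) :=
      (contMDiff_mul I ∞).mdifferentiable (by simp)
    have h := tangentMap_comp_at (I := I.prod I) (I' := I) (I'' := J) (g := γ)
      (f := fun p : G × G => p.1 * p.2) Z (hγ _) (hm _)
    refine h.symm.trans ?_
    have e : (γ ∘ fun p : G × G => p.1 * p.2) = fun p => (γ ∘ Prod.fst) p * (γ ∘ Prod.snd) p := by
      funext p; simp
    rw [e, tangentMap_mul (hγ.comp mdifferentiable_fst) (hγ.comp mdifferentiable_snd),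
      tangentMap_comp_at (I' := I) _ (hγ _) mdifferentiableAt_fst,
      tangentMap_comp_at (I' := I) _ (hγ _) mdifferentiableAt_snd, tangentMap_prodFst,
      tangentMap_prodSnd]
    rfl
  contMDiff_toFun := γ.contMDiff_toFun.contMDiff_tangentMap (by simp)

end TangentGroup
section TangentVector

variable {V : Type*} [NormedAddCommGroup V] [NormedSpace ℝ V]

/-- The sum `X ⊕ Y = (Tτ_y) X + (Tτ_x) Y` for `X ∈ T_x V`, `Y ∈ T_y V`, where `τ_z` is the
translation by `z`; the right-hand side is a sum in `T_{x + y} V`. -/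
instance instAddTangent : Add (TangentBundle 𝓘(ℝ, V) V) where
  add X Y := ⟨X.proj + Y.proj,
    (mfderiv 𝓘(ℝ, V) 𝓘(ℝ, V) (fun z : V => z + Y.proj) X.proj X.snd :
        TangentSpace 𝓘(ℝ, V) (X.proj + Y.proj))
      + (mfderiv 𝓘(ℝ, V) 𝓘(ℝ, V) (fun z : V => X.proj + z) Y.proj Y.snd :
        TangentSpace 𝓘(ℝ, V) (X.proj + Y.proj))⟩

/-- The scalar multiple `c • X = (Tσ_c) X`, where `σ_c` is the multiplication by `c`. -/
instance instSMulTangent : SMul ℝ (TangentBundle 𝓘(ℝ, V) V) where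
  smul c X := tangentMap 𝓘(ℝ, V) 𝓘(ℝ, V) (fun z : V => c • z) X

instance instZeroTangent : Zero (TangentBundle 𝓘(ℝ, V) V) where
  zero := ⟨0, 0⟩

instance instNegTangent : Neg (TangentBundle 𝓘(ℝ, V) V) where
  neg X := (-1 : ℝ) • X

/-- The identification of `TV` with `V × V`: base point and vector. -/
def toProd : TangentBundle 𝓘(ℝ, V) V ≃ V × V where
  toFun X := (X.proj, X.snd)
  invFun p := ⟨p.1, p.2⟩

lemma toProd_add (X Y : TangentBundle 𝓘(ℝ, V) V) : toProd (X + Y) = toProd X + toProd Y := by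
  refine Prod.ext rfl ?_
  change (mfderiv 𝓘(ℝ, V) 𝓘(ℝ, V) (fun z : V => z + Y.proj) X.proj X.snd : V)
      + (mfderiv 𝓘(ℝ, V) 𝓘(ℝ, V) (fun z : V => X.proj + z) Y.proj Y.snd : V) = (toProd X).2 + (toProd Y).2
  rw [mfderiv_eq_fderiv, mfderiv_eq_fderiv, fderiv_add_const, fderiv_const_add]
  simp only [fderiv_fun_id]
  rfl

lemma toProd_smul (c : ℝ) (X : TangentBundle 𝓘(ℝ, V) V) : toProd (c • X) = c • toProd X := by
  refine Prod.ext rfl ?_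
  change (mfderiv 𝓘(ℝ, V) 𝓘(ℝ, V) (fun z : V => c • z) X.proj X.snd : V) = c • (toProd X).2
  rw [mfderiv_eq_fderiv, fderiv_fun_const_smul differentiableAt_fun_id]
  simp only [fderiv_fun_id]
  rfl

lemma toProd_zero : toProd (0 : TangentBundle 𝓘(ℝ, V) V) = 0 := rfl

lemma toProd_neg (X : TangentBundle 𝓘(ℝ, V) V) : toProd (-X) = -toProd X := by
  change toProd ((-1 : ℝ) • X) = _
  rw [toProd_smul, neg_one_smul]

instance instAddCommGroupTangent : AddCommGroup (TangentBundle 𝓘(ℝ, V) V) where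
  add_assoc X Y Z := toProd.injective (by simp only [toProd_add, add_assoc])
  zero_add X := toProd.injective (by simp only [toProd_add, toProd_zero, zero_add])
  add_zero X := toProd.injective (by simp only [toProd_add, toProd_zero, add_zero])
  neg_add_cancel X := toProd.injective (by
    simp only [toProd_add, toProd_zero, toProd_neg, neg_add_cancel])
  add_comm X Y := toProd.injective (by simp only [toProd_add, add_comm])
  nsmul := nsmulRec
  zsmul := zsmulRec

instance instModuleTangent : Module ℝ (TangentBundle 𝓘(ℝ, V) V) where
  one_smul X := toProd.injective (by simp only [toProd_smul, one_smul])
  mul_smul c d X := toProd.injective (by simp only [toProd_smul, mul_smul])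
  smul_zero c := toProd.injective (by simp only [toProd_smul, toProd_zero, smul_zero])
  smul_add c X Y := toProd.injective (by simp only [toProd_smul, toProd_add, smul_add])
  add_smul c d X := toProd.injective (by simp only [toProd_smul, toProd_add, add_smul])
  zero_smul X := toProd.injective (by simp only [toProd_smul, toProd_zero, zero_smul])

/-- `toProd` as a linear isomorphism. -/
def toProdₗ : TangentBundle 𝓘(ℝ, V) V ≃ₗ[ℝ] V × V :=
  { toProd with
    map_add' := toProd_add
    map_smul' := toProd_smul }

lemma isInducing_toProd :
    Topology.IsInducing (toProdₗ : TangentBundle 𝓘(ℝ, V) V → V × V) :=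
  (tangentBundleModelSpaceHomeomorph 𝓘(ℝ, V)).isInducing

/-- The norm of the vector `v ∈ T_p V` as an element of the vector space `TV` is
`max ‖p‖ ‖v‖`; its topology is (definitionally) that of the tangent bundle. As `TV` is
finite-dimensional when `V` is, the norm only serves to let Mathlib see `TV` and `Aut (TV)` as
manifolds. -/
instance instNormedAddCommGroupTangent : NormedAddCommGroup (TangentBundle 𝓘(ℝ, V) V) :=
  let N : NormedAddCommGroup (TangentBundle 𝓘(ℝ, V) V) :=
    NormedAddCommGroup.induced (TangentBundle 𝓘(ℝ, V) V) (V × V)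
      (toProdₗ : TangentBundle 𝓘(ℝ, V) V ≃ₗ[ℝ] V × V) toProdₗ.injective
  { instAddCommGroupTangent with
    norm := N.norm
    toMetricSpace := N.toMetricSpace.replaceTopology isInducing_toProd.eq_induced
    dist_eq := N.dist_eq }

instance instNormedSpaceTangent : NormedSpace ℝ (TangentBundle 𝓘(ℝ, V) V) where
  norm_smul_le c X := by
    change ‖toProdₗ (c • X)‖ ≤ ‖c‖ * ‖toProdₗ X‖
    rw [map_smul, norm_smul]

instance instFiniteDimensionalTangent [FiniteDimensional ℝ V] :
    FiniteDimensional ℝ (TangentBundle 𝓘(ℝ, V) V) :=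
  Module.Finite.equiv toProdₗ.symm


/-- The bundle trivialization `ψ : TV → V × ℝⁿ` given by the linear coordinates of a basis `α`:
`ψ (∑ vᵢ (∂/∂xᵢ)_p) = (p, v)`. -/
def trivializationEquiv {n : ℕ} (α : Module.Basis (Fin n) ℝ V) :
    TangentBundle 𝓘(ℝ, V) V ≃ₗ[ℝ] V × (Fin n → ℝ) :=
  toProdₗ.trans ((LinearEquiv.refl ℝ V).prodCongr α.equivFun)

/-- The basis `ψ⁻¹ (α₁, 0), …, ψ⁻¹ (αₙ, 0), ψ⁻¹ (0, e₁), …, ψ⁻¹ (0, eₙ)` of `TV`. -/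
def tangentBasis {n : ℕ} (α : Module.Basis (Fin n) ℝ V) :
    Module.Basis (Fin n ⊕ Fin n) ℝ (TangentBundle 𝓘(ℝ, V) V) :=
  (α.prod (Pi.basisFun ℝ (Fin n))).map (trivializationEquiv α).symm

end TangentVector
section Representations

/-- A finite-dimensional real representation `(G, V)` of a Lie group `G`: a (smooth) homomorphism
of Lie groups `G → Aut V`, where `Aut V` is the group of units of `End V`. -/
abbrev LieRep {E : Type*} [NormedAddCommGroup E] [NormedSpace ℝ E] {H : Type*} [TopologicalSpace H]
    (I : ModelWithCorners ℝ E H) (G : Type*) [TopologicalSpace G] [ChartedSpace H G] [Group G]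
    [LieGroup I ∞ G] (V : Type*) [NormedAddCommGroup V] [NormedSpace ℝ V]
    [FiniteDimensional ℝ V] :=
  ContMDiffMonoidMorphism I 𝓘(ℝ, V →L[ℝ] V) ∞ G (V →L[ℝ] V)ˣ

open scoped Matrix.Norms.L2Operator

lemma contMDiff_unitsMap {R S : Type*} [NormedRing R] [NormedAlgebra ℝ R] [CompleteSpace R]
    [NormedRing S] [NormedAlgebra ℝ S] [CompleteSpace S] [FiniteDimensional ℝ R]
    (f : R ≃ₐ[ℝ] S) :
    ContMDiff 𝓘(ℝ, R) 𝓘(ℝ, S) ∞ (Units.mapEquiv f.toMulEquiv : Rˣ → Sˣ) := by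
  apply ContMDiff.of_comp_isOpenEmbedding Units.isOpenEmbedding_val
  have h : ContDiff ℝ ∞ (f : R → S) :=
    (LinearMap.toContinuousLinearMap f.toLinearMap).contDiff
  exact h.contMDiff.comp (Units.contMDiff_val (𝕜 := ℝ) (R := R))

variable {V : Type*} [NormedAddCommGroup V] [NormedSpace ℝ V] [FiniteDimensional ℝ V]

/-- The isomorphism of algebras that maps an endomorphism of `V` to its matrix in a basis. -/
def endEquivMatrix {ι : Type*} [Fintype ι] [DecidableEq ι] (α : Module.Basis ι ℝ V) :
    (V →L[ℝ] V) ≃ₐ[ℝ] Matrix ι ι ℝ :=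
  (Module.End.toContinuousLinearMap (𝕜 := ℝ) V).symm.trans (LinearMap.toMatrixAlgEquiv α)

/-- The group isomorphism `Z : Aut V → GL(ι, ℝ)` that maps an automorphism to its matrix in a
basis. -/
def autEquivGL {ι : Type*} [Fintype ι] [DecidableEq ι] (α : Module.Basis ι ℝ V) :
    (V →L[ℝ] V)ˣ ≃* GL ι ℝ :=
  Units.mapEquiv (endEquivMatrix α).toMulEquiv

lemma contMDiff_autEquivGL {ι : Type*} [Fintype ι] [DecidableEq ι] (α : Module.Basis ι ℝ V) :
    ContMDiff 𝓘(ℝ, V →L[ℝ] V) 𝓘(ℝ, Matrix ι ι ℝ) ∞ (autEquivGL α) :=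
  contMDiff_unitsMap (endEquivMatrix α)

lemma contMDiff_autEquivGL_symm {ι : Type*} [Fintype ι] [DecidableEq ι]
    (α : Module.Basis ι ℝ V) :
    ContMDiff 𝓘(ℝ, Matrix ι ι ℝ) 𝓘(ℝ, V →L[ℝ] V) ∞ (autEquivGL α).symm :=
  contMDiff_unitsMap (endEquivMatrix α).symm

/-- `Z` as a homomorphism of Lie groups. -/
def autToGL {n : ℕ} (α : Module.Basis (Fin n) ℝ V) :
    ContMDiffMonoidMorphism 𝓘(ℝ, V →L[ℝ] V) 𝓘(ℝ, Matrix (Fin n) (Fin n) ℝ) ∞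
      (V →L[ℝ] V)ˣ (GL (Fin n) ℝ) where
  toMonoidHom := (autEquivGL α).toMonoidHom
  contMDiff_toFun := contMDiff_autEquivGL α

section J

variable {n : ℕ}

/-- The matrix of entries of a tangent vector of `GL(n, ℝ)`, an open subset of the space of
matrices. -/
def tangentMatrix (Y : TangentBundle 𝓘(ℝ, Matrix (Fin n) (Fin n) ℝ) (GL (Fin n) ℝ)) :
    Matrix (Fin n) (Fin n) ℝ :=
  (tangentMap 𝓘(ℝ, Matrix (Fin n) (Fin n) ℝ) 𝓘(ℝ, Matrix (Fin n) (Fin n) ℝ)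
    (Units.val : GL (Fin n) ℝ → Matrix (Fin n) (Fin n) ℝ) Y).snd

/-- For `Y ∈ T_a GL(n, ℝ)`, the matrix `B` of the vector `TR_{a⁻¹} Y` of the Lie algebra of
`GL(n, ℝ)`, where `R_{a⁻¹}` is the right translation; so `Y = [a, B]`. -/
def rightLog (Y : TangentBundle 𝓘(ℝ, Matrix (Fin n) (Fin n) ℝ) (GL (Fin n) ℝ)) :
    Matrix (Fin n) (Fin n) ℝ :=
  tangentMatrix (tangentMap 𝓘(ℝ, Matrix (Fin n) (Fin n) ℝ) 𝓘(ℝ, Matrix (Fin n) (Fin n) ℝ)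
    (fun y : GL (Fin n) ℝ => y * Y.proj⁻¹) Y)

/-- The map `J_n : T GL(n, ℝ) → GL(2n, ℝ)`, which sends `[a, B]` to the block matrix with rows
`(a, 0)` and `(B a, a)`. -/
def jMap (Y : TangentBundle 𝓘(ℝ, Matrix (Fin n) (Fin n) ℝ) (GL (Fin n) ℝ)) :
    GL (Fin n ⊕ Fin n) ℝ where
  val := Matrix.fromBlocks (Y.proj : Matrix (Fin n) (Fin n) ℝ) 0
    (rightLog Y * (Y.proj : Matrix (Fin n) (Fin n) ℝ)) (Y.proj : Matrix (Fin n) (Fin n) ℝ)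
  inv := Matrix.fromBlocks ((Y.proj⁻¹ : GL (Fin n) ℝ) : Matrix (Fin n) (Fin n) ℝ) 0
    (-(((Y.proj⁻¹ : GL (Fin n) ℝ) : Matrix (Fin n) (Fin n) ℝ) * rightLog Y))
    ((Y.proj⁻¹ : GL (Fin n) ℝ) : Matrix (Fin n) (Fin n) ℝ)
  val_inv := by
    rw [Matrix.fromBlocks_multiply, ← Matrix.fromBlocks_one]
    congr 1 <;> simp [← mul_assoc]
  inv_val := by
    rw [Matrix.fromBlocks_multiply, ← Matrix.fromBlocks_one]
    congr 1 <;> simp [mul_assoc]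

lemma mdiff_val : MDifferentiable 𝓘(ℝ, Matrix (Fin n) (Fin n) ℝ) 𝓘(ℝ, Matrix (Fin n) (Fin n) ℝ)
    (Units.val : GL (Fin n) ℝ → Matrix (Fin n) (Fin n) ℝ) :=
  (Units.contMDiff_val (𝕜 := ℝ) (n := ∞)).mdifferentiable (by simp)

lemma tangentMatrix_mul (X Y : TangentBundle 𝓘(ℝ, Matrix (Fin n) (Fin n) ℝ) (GL (Fin n) ℝ)) :
    tangentMatrix (X * Y) =
      tangentMatrix X * (Y.proj : Matrix (Fin n) (Fin n) ℝ)
        + (X.proj : Matrix (Fin n) (Fin n) ℝ) * tangentMatrix Y := by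
  let J := 𝓘(ℝ, Matrix (Fin n) (Fin n) ℝ)
  have hX := ((mdiff_val (n := n)) X.proj).hasMFDerivAt
  have hY := ((mdiff_val (n := n)) Y.proj).hasMFDerivAt
  have h1 := HasMFDerivAt.comp (I := J.prod J) (I' := J) (I'' := J) (X.proj, Y.proj) hX
    (hasMFDerivAt_fst (I := J) (I' := J) (X.proj, Y.proj))
  have h2 := HasMFDerivAt.comp (I := J.prod J) (I' := J) (I'' := J) (X.proj, Y.proj) hY
    (hasMFDerivAt_snd (I := J) (I' := J) (X.proj, Y.proj))
  have h := (HasMFDerivAt.mul' h1 h2).mfderiv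
  have hm : MDifferentiable (J.prod J) J (fun p : GL (Fin n) ℝ × GL (Fin n) ℝ => p.1 * p.2) :=
    (contMDiff_mul J ∞).mdifferentiable (by simp)
  have hc := mfderiv_comp (I := J.prod J) (I' := J) (I'' := J) (X.proj, Y.proj)
    ((mdiff_val (n := n)) (X.proj * Y.proj)) (hm (X.proj, Y.proj))
  have h3 := hc.symm.trans h
  have h4 := DFunLike.congr_fun h3 (X.snd, Y.snd)
  refine h4.trans ?_
  rw [add_comm]
  rfl

lemma rightLog_mul (Y : TangentBundle 𝓘(ℝ, Matrix (Fin n) (Fin n) ℝ) (GL (Fin n) ℝ)) :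
    rightLog Y * (Y.proj : Matrix (Fin n) (Fin n) ℝ) = tangentMatrix Y := by
  have h := tangentMap_mul (I := 𝓘(ℝ, Matrix (Fin n) (Fin n) ℝ))
    (J := 𝓘(ℝ, Matrix (Fin n) (Fin n) ℝ)) (u := (id : GL (Fin n) ℝ → GL (Fin n) ℝ))
    (v := fun _ => Y.proj⁻¹) mdifferentiable_id mdifferentiable_const Y
  have h0 : tangentMatrix (tangentMap 𝓘(ℝ, Matrix (Fin n) (Fin n) ℝ)
      𝓘(ℝ, Matrix (Fin n) (Fin n) ℝ) (fun _ : GL (Fin n) ℝ => Y.proj⁻¹) Y) = 0 := by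
    simp only [tangentMatrix, tangentMap, mfderiv_const]
    exact map_zero _
  have h1 : rightLog Y = tangentMatrix Y * ((Y.proj⁻¹ : GL (Fin n) ℝ) : Matrix _ _ ℝ) := by
    refine (congrArg tangentMatrix h).trans ?_
    rw [tangentMatrix_mul, h0, mul_zero, add_zero, tangentMap_id]
    rfl
  rw [h1, mul_assoc, Units.inv_mul, mul_one]

lemma contMDiff_tangentMatrix :
    ContMDiff 𝓘(ℝ, Matrix (Fin n) (Fin n) ℝ).tangent 𝓘(ℝ, Matrix (Fin n) (Fin n) ℝ) ∞
      (tangentMatrix (n := n)) :=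
  (contMDiff_snd_tangentBundle_modelSpace (Matrix (Fin n) (Fin n) ℝ)
    𝓘(ℝ, Matrix (Fin n) (Fin n) ℝ)).comp
    ((Units.contMDiff_val (𝕜 := ℝ) (n := ∞)).contMDiff_tangentMap (by simp))

/-- `(a, c) ↦ fromBlocks a 0 c a` as a linear map. -/
def blockMap : Matrix (Fin n) (Fin n) ℝ × Matrix (Fin n) (Fin n) ℝ →ₗ[ℝ]
    Matrix (Fin n ⊕ Fin n) (Fin n ⊕ Fin n) ℝ where
  toFun p := Matrix.fromBlocks p.1 0 p.2 p.1
  map_add' p q := by simp [Matrix.fromBlocks_add]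
  map_smul' c p := by simp [Matrix.fromBlocks_smul]

/-- `J_n` as a homomorphism of Lie groups. -/
def jHom : ContMDiffMonoidMorphism 𝓘(ℝ, Matrix (Fin n) (Fin n) ℝ).tangent
    𝓘(ℝ, Matrix (Fin n ⊕ Fin n) (Fin n ⊕ Fin n) ℝ) ∞
    (TangentBundle 𝓘(ℝ, Matrix (Fin n) (Fin n) ℝ) (GL (Fin n) ℝ)) (GL (Fin n ⊕ Fin n) ℝ) where
  toMonoidHom := MonoidHom.mk' jMap fun X Y => by
    apply Units.ext
    change Matrix.fromBlocks (X.proj.val * Y.proj.val) 0 (rightLog (X * Y) * (X * Y).proj.val)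
        (X.proj.val * Y.proj.val)
      = Matrix.fromBlocks X.proj.val 0 (rightLog X * X.proj.val) X.proj.val
        * Matrix.fromBlocks Y.proj.val 0 (rightLog Y * Y.proj.val) Y.proj.val
    rw [rightLog_mul, rightLog_mul, rightLog_mul, tangentMatrix_mul, Matrix.fromBlocks_multiply]
    simp only [mul_zero, zero_mul, add_zero, zero_add]
  contMDiff_toFun := by
    apply ContMDiff.of_comp_isOpenEmbedding Units.isOpenEmbedding_val
    have hp : ContMDiff 𝓘(ℝ, Matrix (Fin n) (Fin n) ℝ).tangent 𝓘(ℝ, Matrix (Fin n) (Fin n) ℝ) ∞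
        (fun Y : TangentBundle 𝓘(ℝ, Matrix (Fin n) (Fin n) ℝ) (GL (Fin n) ℝ) =>
          (Y.proj : Matrix (Fin n) (Fin n) ℝ)) :=
      (Units.contMDiff_val (𝕜 := ℝ) (n := ∞)).comp (contMDiff_proj _)
    have h := ((LinearMap.toContinuousLinearMap (blockMap (n := n))).contDiff
      (n := ∞)).contMDiff.comp (hp.prodMk_space contMDiff_tangentMatrix)
    refine h.congr fun Y => ?_
    change Matrix.fromBlocks _ _ (rightLog Y * _) _ = _
    rw [rightLog_mul]
    rfl

end J

variable {E : Type*} [NormedAddCommGroup E] [NormedSpace ℝ E] {H : Type*} [TopologicalSpace H]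
  {I : ModelWithCorners ℝ E H} {G : Type*} [TopologicalSpace G] [ChartedSpace H G] [Group G]
  [LieGroup I ∞ G]

/-- The prolongation `Z̆⁻¹ ∘ J_n ∘ TZ ∘ TΦ : TG → Aut (TV)` of a representation `Φ : G → Aut V`.
Here `α` is a basis of `V`, `Z : Aut V → GL(n, ℝ)` is the isomorphism it defines, and
`Z̆ : Aut (TV) → GL(2n, ℝ)` is the isomorphism defined by the basis `tangentBasis α` of `TV`. -/
def LieRep.prolongation {n : ℕ} (α : Module.Basis (Fin n) ℝ V) (Φ : LieRep I G V) :
    LieRep I.tangent (TangentBundle I G) (TangentBundle 𝓘(ℝ, V) V) where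
  toMonoidHom := (autEquivGL (tangentBasis α)).symm.toMonoidHom.comp
    ((jHom (n := n)).toMonoidHom.comp
      ((tangentHom (autToGL α)).toMonoidHom.comp (tangentHom Φ).toMonoidHom))
  contMDiff_toFun := (contMDiff_autEquivGL_symm (tangentBasis α)).comp
    ((jHom (n := n)).contMDiff_toFun.comp
      ((tangentHom (autToGL α)).contMDiff_toFun.comp (tangentHom Φ).contMDiff_toFun))

variable {V' : Type*} [NormedAddCommGroup V'] [NormedSpace ℝ V'] [FiniteDimensional ℝ V']

/-- `A : V → V'` is an equivalence from `Φ` to `Φ'`: a linear isomorphism with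
`A (Φ(g) p) = Φ'(g) (A p)`. -/
def LieRep.IsIntertwining (Φ : LieRep I G V) (Φ' : LieRep I G V') (A : V ≃ₗ[ℝ] V') : Prop :=
  ∀ (g : G) (p : V), A ((Φ g : V →L[ℝ] V) p) = (Φ' g : V' →L[ℝ] V') (A p)

/-- Equivalent representations. -/
def LieRep.Equivalent (Φ : LieRep I G V) (Φ' : LieRep I G V') : Prop :=
  ∃ A : V ≃ₗ[ℝ] V', LieRep.IsIntertwining Φ Φ' A

end Representations
end Prolongation
end

/-! Identify `TV` with `V × V` by base point and vector. For `X ∈ T_g G`, write `dΦ(X)` for the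
derivative along `X` of `Φ` seen as a map into the vector space `End V`. The prolongation then has a
description free of bases: `(p, v) ↦ (Φ(g) p, dΦ(X) p + Φ(g) v)`. Indeed, in the block matrix `J_n`
the factor `a` in `B a` undoes the right translation by `a⁻¹`, so the lower left block is just the
matrix of `dΦ(X)`. This is `toProdₗ_prolongation`, with the block computed in
`tangentMatrix_tangentHom`.

In the same picture `TA` is `(p, v) ↦ (A p, A v)`. Commuting with the prolongations therefore
amounts to two identities: the intertwining relation itself, and its derivative in `g`, namely `A
(dΦ(X) p) = dΦ'(X) (A p)`, which is `LieRep.IsIntertwining.derivEnd`. Equivalence of the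
prolongations follows because `TA` is a linear isomorphism. -/

namespace Prolongation

/-! ### Linear maps and bases under the identification of `TV` with `V × V` -/

section LinearMaps

variable {E : Type*} [NormedAddCommGroup E] [NormedSpace ℝ E] {H : Type*} [TopologicalSpace H]
  {I : ModelWithCorners ℝ E H}
  {V : Type*} [NormedAddCommGroup V] [NormedSpace ℝ V]
  {V' : Type*} [NormedAddCommGroup V'] [NormedSpace ℝ V']

/-- The derivative of a linear map after a differentiable one, with values in normed spaces. -/
lemma mfderiv_clm_comp_apply {M F F' : Type*} [TopologicalSpace M] [ChartedSpace H M]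
    [NormedAddCommGroup F] [NormedSpace ℝ F]
    [NormedAddCommGroup F'] [NormedSpace ℝ F'] (L : F →L[ℝ] F') {f : M → F} {m : M}
    (hf : MDifferentiableAt I 𝓘(ℝ, F) f m) (ξ : TangentSpace I m) :
    (mfderiv I 𝓘(ℝ, F') (fun x => L (f x)) m ξ : F') = L (mfderiv I 𝓘(ℝ, F) f m ξ : F) := by
  have h := (L.hasMFDerivAt (x := f m)).comp m hf.hasMFDerivAt
  exact DFunLike.congr_fun h.mfderiv ξ

/-- The vector `ψ⁻¹ (0, eᵢ)` is `αᵢ` placed at the origin, so both halves of the basis are copies of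
`α`: the first reads off the base point, the second the vector. -/
lemma tangentBasis_repr_inl {n : ℕ} (α : Module.Basis (Fin n) ℝ V)
    (Y : TangentBundle 𝓘(ℝ, V) V) (i : Fin n) :
    (tangentBasis α).repr Y (Sum.inl i) = α.repr (toProdₗ Y).1 i := by
  simp [tangentBasis, trivializationEquiv]

lemma tangentBasis_repr_inr {n : ℕ} (α : Module.Basis (Fin n) ℝ V)
    (Y : TangentBundle 𝓘(ℝ, V) V) (i : Fin n) :
    (tangentBasis α).repr Y (Sum.inr i) = α.repr (toProdₗ Y).2 i := by
  simp [tangentBasis, trivializationEquiv]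

/-- The tangent map of a linear isomorphism, as a linear isomorphism. -/
noncomputable def tangentLinearEquiv (A : V ≃ₗ[ℝ] V') :
    TangentBundle 𝓘(ℝ, V) V ≃ₗ[ℝ] TangentBundle 𝓘(ℝ, V') V' :=
  toProdₗ.trans ((A.prodCongr A).trans toProdₗ.symm)

/-- A linear map is its own derivative at every point; finite dimension supplies the continuity of
`A`. -/
lemma tangentLinearEquiv_apply [FiniteDimensional ℝ V] (A : V ≃ₗ[ℝ] V') (Y : TangentBundle 𝓘(ℝ, V) V) :
    tangentLinearEquiv A Y = tangentMap 𝓘(ℝ, V) 𝓘(ℝ, V') A Y := by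
  let A' : V →L[ℝ] V' := LinearMap.toContinuousLinearMap A.toLinearMap
  have h : mfderiv 𝓘(ℝ, V) 𝓘(ℝ, V') A Y.proj = A' := (A'.hasMFDerivAt (x := Y.proj)).mfderiv
  simp only [tangentMap]
  rw [h]
  rfl

lemma toProdₗ_tangentLinearEquiv (A : V ≃ₗ[ℝ] V') (Y : TangentBundle 𝓘(ℝ, V) V) :
    toProdₗ (tangentLinearEquiv A Y) = (A (toProdₗ Y).1, A (toProdₗ Y).2) :=
  rfl

end LinearMaps

/-! ### The prolongation as a formula free of bases, and its naturality -/

section Representations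

open scoped Matrix.Norms.L2Operator

variable {E : Type*} [NormedAddCommGroup E] [NormedSpace ℝ E] {H : Type*} [TopologicalSpace H]
  {I : ModelWithCorners ℝ E H} {G : Type*} [TopologicalSpace G] [ChartedSpace H G] [Group G]
  [LieGroup I ∞ G]
  {V : Type*} [NormedAddCommGroup V] [NormedSpace ℝ V] [FiniteDimensional ℝ V]
  {V' : Type*} [NormedAddCommGroup V'] [NormedSpace ℝ V'] [FiniteDimensional ℝ V']

/-- The derivative of a representation `Φ`, seen as a map `G → End V`, along a tangent vector
of `G`. -/
noncomputable def LieRep.derivEnd (Φ : LieRep I G V) (X : TangentBundle I G) : V →L[ℝ] V :=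
  mfderiv I 𝓘(ℝ, V →L[ℝ] V) (fun g : G => (Φ g : V →L[ℝ] V)) X.proj X.snd

lemma LieRep.mdifferentiable (Φ : LieRep I G V) : MDifferentiable I 𝓘(ℝ, V →L[ℝ] V) Φ :=
  Φ.contMDiff_toFun.mdifferentiable (by simp)

lemma LieRep.mdifferentiable_val (Φ : LieRep I G V) :
    MDifferentiable I 𝓘(ℝ, V →L[ℝ] V) (fun g : G => (Φ g : V →L[ℝ] V)) :=
  ((Units.contMDiff_val (𝕜 := ℝ) (n := ∞)).comp Φ.contMDiff_toFun).mdifferentiable (by simp)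

/-- The derivative of the matrix of a representation is the matrix of its derivative. -/
lemma tangentMatrix_tangentHom {n : ℕ} (α : Module.Basis (Fin n) ℝ V) (Φ : LieRep I G V)
    (X : TangentBundle I G) :
    tangentMatrix (tangentHom (autToGL α) (tangentHom Φ X)) =
      endEquivMatrix α (LieRep.derivEnd Φ X) := by
  have hZ : MDifferentiable 𝓘(ℝ, V →L[ℝ] V) 𝓘(ℝ, Matrix (Fin n) (Fin n) ℝ) (autToGL α) :=
    (autToGL α).contMDiff_toFun.mdifferentiable (by simp)
  have hZΦ := hZ.comp Φ.mdifferentiable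
  -- Both `tangentHom`s are tangent maps, so the chain rule merges them with that of the inclusion
  -- of `GL(n, ℝ)` in the matrices.
  have h : tangentMap 𝓘(ℝ, Matrix (Fin n) (Fin n) ℝ) 𝓘(ℝ, Matrix (Fin n) (Fin n) ℝ)
      (Units.val : GL (Fin n) ℝ → Matrix (Fin n) (Fin n) ℝ)
        (tangentHom (autToGL α) (tangentHom Φ X)) =
      tangentMap I 𝓘(ℝ, Matrix (Fin n) (Fin n) ℝ)
        (Units.val ∘ (autToGL α ∘ Φ)) X := by
    rw [tangentMap_comp_at (I' := 𝓘(ℝ, Matrix (Fin n) (Fin n) ℝ)) X (mdiff_val _) (hZΦ _),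
      tangentMap_comp_at (I' := 𝓘(ℝ, V →L[ℝ] V)) X (hZ _) (Φ.mdifferentiable _)]
    rfl
  -- Unfolded, `Units.val ∘ (autToGL α ∘ Φ)` is the linear map `endEquivMatrix α` applied to `Φ` as
  -- a map into `End V`, and a linear map commutes with differentiation.
  exact (congrArg (fun Y : TangentBundle 𝓘(ℝ, Matrix (Fin n) (Fin n) ℝ)
    (Matrix (Fin n) (Fin n) ℝ) => (Y.snd : Matrix (Fin n) (Fin n) ℝ)) h).trans
    (mfderiv_clm_comp_apply (LinearMap.toContinuousLinearMap (endEquivMatrix α).toLinearMap)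
      (Φ.mdifferentiable_val X.proj) X.snd)

lemma endEquivMatrix_mulVec_repr {ι : Type*} [Fintype ι] [DecidableEq ι]
    (α : Module.Basis ι ℝ V) (f : V →L[ℝ] V) (v : V) :
    Matrix.mulVec (endEquivMatrix α f) (α.repr v) = α.repr (f v) :=
  LinearMap.toMatrix_mulVec_repr α α (f : V →ₗ[ℝ] V) v

/-- The prolongation maps the vector `v` at `p` to `(dΦ(X)) p + Φ(g) v` at `Φ(g) p`. -/
lemma toProdₗ_prolongation {n : ℕ} (α : Module.Basis (Fin n) ℝ V) (Φ : LieRep I G V)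
    (X : TangentBundle I G) (Y : TangentBundle 𝓘(ℝ, V) V) :
    toProdₗ ((LieRep.prolongation α Φ X : TangentBundle 𝓘(ℝ, V) V →L[ℝ] TangentBundle 𝓘(ℝ, V) V) Y) =
      ((Φ X.proj : V →L[ℝ] V) (toProdₗ Y).1,
        LieRep.derivEnd Φ X (toProdₗ Y).1 + (Φ X.proj : V →L[ℝ] V) (toProdₗ Y).2) := by
  set W := (LieRep.prolongation α Φ X : TangentBundle 𝓘(ℝ, V) V →L[ℝ] TangentBundle 𝓘(ℝ, V) V) with hW
  -- Applying `Z̆` cancels the outer `Z̆⁻¹` of the prolongation and leaves the matrix `J_n`.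
  have hM : endEquivMatrix (tangentBasis α) W =
      Matrix.fromBlocks (endEquivMatrix α (Φ X.proj)) 0
        (endEquivMatrix α (LieRep.derivEnd Φ X)) (endEquivMatrix α (Φ X.proj)) := by
    have h : autEquivGL (tangentBasis α) (LieRep.prolongation α Φ X) =
        jMap (tangentHom (autToGL α) (tangentHom Φ X)) :=
      (autEquivGL (tangentBasis α)).apply_symm_apply _
    refine (congrArg Units.val h).trans ?_
    -- The matrix of `dΦ(X)` is rewritten backwards into the product `B a`, the form in which `jMap`
    -- has its lower left block.
    rw [← tangentMatrix_tangentHom, ← rightLog_mul]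
    rfl
  have h := endEquivMatrix_mulVec_repr (tangentBasis α) W Y
  -- With the coordinate vector split in two halves, the block matrix acts on it block by block, and
  -- each block acts as an endomorphism of `V` in the basis `α`.
  have hY : ⇑((tangentBasis α).repr Y) =
      Sum.elim (α.repr (toProdₗ Y).1) (α.repr (toProdₗ Y).2) := by
    funext i
    cases i
    · exact tangentBasis_repr_inl α Y _
    · exact tangentBasis_repr_inr α Y _
  rw [hM, hY, Matrix.fromBlocks_mulVec] at h
  simp only [Sum.elim_comp_inl, Sum.elim_comp_inr, endEquivMatrix_mulVec_repr,
    Matrix.zero_mulVec, add_zero] at h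
  refine Prod.ext (α.repr.injective (Finsupp.ext fun i => ?_))
    (α.repr.injective (Finsupp.ext fun i => ?_))
  · rw [← tangentBasis_repr_inl]
    exact (congrFun h (Sum.inl i)).symm
  · rw [← tangentBasis_repr_inr, map_add]
    exact (congrFun h (Sum.inr i)).symm

/-- For fixed `p`, both sides of the intertwining relation are functions of `g` with values in `V'`;
their derivatives along `X` agree. -/
lemma LieRep.IsIntertwining.derivEnd {Φ : LieRep I G V} {Φ' : LieRep I G V'} {A : V ≃ₗ[ℝ] V'}
    (hA : LieRep.IsIntertwining Φ Φ' A) (X : TangentBundle I G) (p : V) :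
    A (LieRep.derivEnd Φ X p) = LieRep.derivEnd Φ' X (A p) := by
  let A' : V →L[ℝ] V' := LinearMap.toContinuousLinearMap A.toLinearMap
  -- The maps `T ↦ A (T p)` on `End V` and `T ↦ T (A p)` on `End V'` are linear, so only the
  -- derivatives of `Φ` and `Φ'` enter.
  have h1 := mfderiv_clm_comp_apply (A'.comp (ContinuousLinearMap.apply ℝ V p))
    (Φ.mdifferentiable_val X.proj) X.snd
  have h2 := mfderiv_clm_comp_apply (ContinuousLinearMap.apply ℝ V' (A p))
    (Φ'.mdifferentiable_val X.proj) X.snd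
  have e : (fun g : G => (A'.comp (ContinuousLinearMap.apply ℝ V p)) (Φ g : V →L[ℝ] V)) =
      fun g : G => ContinuousLinearMap.apply ℝ V' (A p) (Φ' g : V' →L[ℝ] V') :=
    funext fun g => hA g p
  rw [e] at h1
  exact h1.symm.trans h2

/-- The tangent map of an intertwining isomorphism intertwines the prolongations. -/
lemma LieRep.IsIntertwining.prolongation {n n' : ℕ} (α : Module.Basis (Fin n) ℝ V)
    (α' : Module.Basis (Fin n') ℝ V') {Φ : LieRep I G V} {Φ' : LieRep I G V'} {A : V ≃ₗ[ℝ] V'}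
    (hA : LieRep.IsIntertwining Φ Φ' A) :
    LieRep.IsIntertwining (LieRep.prolongation α Φ) (LieRep.prolongation α' Φ')
      (tangentLinearEquiv A) := fun X Y => by
  -- Compared in `V' × V'`, neither side mentions a basis any more, which is why `α` and `α'` need
  -- not correspond under `A`.
  apply toProdₗ.injective
  rw [toProdₗ_tangentLinearEquiv, toProdₗ_prolongation, toProdₗ_prolongation,
    toProdₗ_tangentLinearEquiv]
  -- The base points agree by `hA`; the vectors need `hA` for the term `Φ(g) v` and its derivative
  -- for the term `dΦ(X) p`.
  simp only [map_add, hA.derivEnd X, hA X.proj _]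

end Representations

end Prolongation

theorem proposition3p8
    {E : Type*} [NormedAddCommGroup E] [NormedSpace ℝ E]
    {H : Type*} [TopologicalSpace H] {I : ModelWithCorners ℝ E H}
    {G : Type*} [TopologicalSpace G] [ChartedSpace H G] [Group G] [LieGroup I ∞ G]
    {V : Type*} [NormedAddCommGroup V] [NormedSpace ℝ V] [FiniteDimensional ℝ V]
    {V' : Type*} [NormedAddCommGroup V'] [NormedSpace ℝ V'] [FiniteDimensional ℝ V']
    {n n' : ℕ} (α : Module.Basis (Fin n) ℝ V) (α' : Module.Basis (Fin n') ℝ V')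
    (Φ : Prolongation.LieRep I G V) (Φ' : Prolongation.LieRep I G V') :
    (Prolongation.LieRep.Equivalent Φ Φ' →
      Prolongation.LieRep.Equivalent (Prolongation.LieRep.prolongation α Φ)
        (Prolongation.LieRep.prolongation α' Φ')) ∧
    ∀ A : V ≃ₗ[ℝ] V', Prolongation.LieRep.IsIntertwining Φ Φ' A →
      ∃ TA : TangentBundle 𝓘(ℝ, V) V ≃ₗ[ℝ] TangentBundle 𝓘(ℝ, V') V',
        (∀ Y, TA Y = tangentMap 𝓘(ℝ, V) 𝓘(ℝ, V') A Y) ∧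
        Prolongation.LieRep.IsIntertwining (Prolongation.LieRep.prolongation α Φ)
          (Prolongation.LieRep.prolongation α' Φ') TA := by
  exact ⟨fun ⟨A, hA⟩ => ⟨Prolongation.tangentLinearEquiv A, hA.prolongation α α'⟩,
    fun A hA => ⟨Prolongation.tangentLinearEquiv A, Prolongation.tangentLinearEquiv_apply A,
      hA.prolongation α α'⟩⟩
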